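/- **Theorem (Bound on the Le Cam distance).** Let $p\in(0,1)$ and $q := 1-p$. For $r>0$, let $\mathbb{P}_{r,p}$ be the negative binomial law on $\mathbb{N}_0$ with probability mass function $$\mathbb{P}_{r,p}(\{k\}) = \frac{\Gamma(r+k)}{\Gamma(r)\,k!}\,q^r p^k,\qquad k\in\mathbb{N}_0,$$ and let $\mathbb{Q}_{r,p}$ be the normal law on $\mathbb{R}$ with mean $rp/q$ and variance $rp/q^2$. For $r_0>0$ define the experiments $\mathscr{P} := \{\mathbb{P}_{r,p}\}_{r\ge r_0}$ and $\mathscr{Q} := \{\mathbb{Q}_{r,p}\}_{r\ge r_0}$ (with $r$ ranging over the real numbers $\ge r_0$), and the deficiencies $$\delta(\mathscr{P},\mathscr{Q}) := \inf_{T_1}\sup_{r\ge r_0}\Big\|\int_{\mathbb{N}_0}T_1(k,\cdot)\,\mathbb{P}_{r,p}(\mathrm{d}k)-\mathbb{Q}_{r,p}\Big\|,\qquad \delta(\mathscr{Q},\mathscr{P}) := \inf_{T_2}\sup_{r\ge r_0}\Big\|\mathbb{P}_{r,p}-\int_{\mathbb{R}}T_2(z,\cdot)\,\mathbb{Q}_{r,p}(\mathrm{d}z)\Big\|,$$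 where $\|\cdot\|$ is the total variation norm of a finite signed measure, $\|\mu\| = |\mu|(\text{whole space})$, and the infima are over all Markov kernels $T_1$ from $\mathbb{N}_0$ to $\mathbb{R}$ and $T_2$ from $\mathbb{R}$ to $\mathbb{N}_0$ (with Borel $\sigma$-algebras), respectively. Then there is a constant $C_p>0$, depending only on $p$, such that for every $r_0>0$, $$\Delta(\mathscr{P},\mathscr{Q}) := \max\{\delta(\mathscr{P},\mathscr{Q}),\,\delta(\mathscr{Q},\mathscr{P})\} \le C_p\, r_0^{-1/2}.$$ -/

import Mathlib

open MeasureTheory ProbabilityTheory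
open scoped ENNReal Nat

namespace LeCam

/-- The negative binomial probability mass function
`Γ(r + k) / (Γ(r) k!) * (1 - p) ^ r * p ^ k`. -/
noncomputable def negBinPMFReal (r p : ℝ) (k : ℕ) : ℝ :=
  Real.Gamma (r + k) / (Real.Gamma r * (k ! : ℝ)) * (1 - p) ^ r * p ^ k

/-- The law on `ℕ` with mass function `negBinPMFReal r p`. -/
noncomputable def negBinMeasure (r p : ℝ) : Measure ℕ :=
  Measure.sum fun k : ℕ ↦ ENNReal.ofReal (negBinPMFReal r p k) • Measure.dirac k

theorem negBinPMFReal_nonneg {r p : ℝ} (hr : 0 < r) (hp : p ∈ Set.Ioo (0 : ℝ) 1) (k : ℕ) :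
    0 ≤ negBinPMFReal r p k := by
  have h1 : 0 < Real.Gamma r := Real.Gamma_pos_of_pos hr
  have h2 : 0 < Real.Gamma (r + k) := Real.Gamma_pos_of_pos (by positivity)
  have h3 : 0 < 1 - p := sub_pos.2 hp.2
  have h4 : 0 < p := hp.1
  unfold negBinPMFReal
  positivity

theorem Gamma_add_nat_eq {r : ℝ} (hr : 0 < r) (k : ℕ) :
    Real.Gamma (r + k) = (ascPochhammer ℝ k).eval r * Real.Gamma r := by
  induction k with
  | zero => simp
  | succ k ih =>
    have h : r + k ≠ 0 := by positivity
    rw [Nat.cast_succ, ← add_assoc, Real.Gamma_add_one h, ih, ascPochhammer_succ_eval]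
    ring

theorem hasSum_negBinPMFReal {r p : ℝ} (hr : 0 < r) (hp : p ∈ Set.Ioo (0 : ℝ) 1) :
    HasSum (negBinPMFReal r p) 1 := by
  have h3 : 0 < 1 - p := sub_pos.2 hp.2
  have hG : Real.Gamma r ≠ 0 := (Real.Gamma_pos_of_pos hr).ne'
  have hball : p ∈ Metric.eball (0 : ℝ) 1 := by
    rw [← ENNReal.ofReal_one, Metric.eball_ofReal, mem_ball_zero_iff, Real.norm_eq_abs,
      abs_of_pos hp.1]
    exact hp.2
  have h := ((Real.one_div_one_sub_rpow_hasFPowerSeriesOnBall_zero r).hasSum hball).mul_left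
    ((1 - p) ^ r)
  have hne : (1 - p) ^ r ≠ 0 := (Real.rpow_pos_of_pos h3 r).ne'
  rw [zero_add, mul_one_div_cancel hne] at h
  convert! h using 1
  funext k
  have hk : (k ! : ℝ) ≠ 0 := by positivity
  have hc : (k ! : ℝ) * Ring.choose (r + k - 1) k = (ascPochhammer ℝ k).eval r := by
    have := Ring.factorial_nsmul_multichoose_eq_ascPochhammer r k
    rw [nsmul_eq_mul, Polynomial.ascPochhammer_smeval_eq_eval] at this
    rw [← this, Ring.choose]
    congr 2
    ring
  simp only [negBinPMFReal, FormalMultilinearSeries.ofScalars_apply_eq, smul_eq_mul]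
  rw [Gamma_add_nat_eq hr, ← hc]
  field_simp

theorem isProbabilityMeasure_negBinMeasure {r p : ℝ} (hr : 0 < r) (hp : p ∈ Set.Ioo (0 : ℝ) 1) :
    IsProbabilityMeasure (negBinMeasure r p) :=
  (hasSum_negBinPMFReal hr hp).isProbabilityMeasure_sum_dirac (negBinPMFReal_nonneg hr hp)

/-- The total variation norm `‖μ - ν‖` of the signed measure `μ - ν`,
that is `|μ - ν|` of the whole space. -/
noncomputable def tvNorm {X : Type*} [MeasurableSpace X] (μ ν : Measure X)
    [IsFiniteMeasure μ] [IsFiniteMeasure ν] : ℝ≥0∞ :=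
  (μ.toSignedMeasure - ν.toSignedMeasure).totalVariation Set.univ

/-- The deficiency of the experiment `P` with respect to the experiment `Q` (same parameter set
`Θ`): the infimum over Markov kernels `T` from `X` to `Y` of
`sup_θ ‖∫ T(x, ·) P_θ(dx) - Q_θ‖`. -/
noncomputable def deficiency {Θ X Y : Type*} [MeasurableSpace X] [MeasurableSpace Y]
    (P : Θ → ProbabilityMeasure X) (Q : Θ → ProbabilityMeasure Y) : ℝ≥0∞ :=
  ⨅ (T : Kernel X Y) (_ : IsMarkovKernel T),
    ⨆ θ : Θ, tvNorm ((P θ : Measure X).bind T) (Q θ : Measure Y)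

/-- The Le Cam distance between two experiments with the same parameter set. -/
noncomputable def leCamDist {Θ X Y : Type*} [MeasurableSpace X] [MeasurableSpace Y]
    (P : Θ → ProbabilityMeasure X) (Q : Θ → ProbabilityMeasure Y) : ℝ≥0∞ :=
  max (deficiency P Q) (deficiency Q P)

/-- The experiment `{NegBin(r, p)}_{r ≥ r₀}`. -/
noncomputable def negBinExperiment {p r₀ : ℝ} (hp : p ∈ Set.Ioo (0 : ℝ) 1) (hr₀ : 0 < r₀) :
    Set.Ici r₀ → ProbabilityMeasure ℕ :=
  fun r ↦ ⟨negBinMeasure r p, isProbabilityMeasure_negBinMeasure (hr₀.trans_le r.2) hp⟩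

/-- The experiment `{Normal(r p / q, r p / q ^ 2)}_{r ≥ r₀}`, where `q = 1 - p`
(mean and variance; the variance is nonnegative for `p ∈ (0, 1)` and `r₀ > 0`). -/
noncomputable def normalExperiment (p r₀ : ℝ) : Set.Ici r₀ → ProbabilityMeasure ℝ :=
  fun r ↦ ⟨gaussianReal (r * p / (1 - p)) (Real.toNNReal (r * p / (1 - p) ^ 2)), inferInstance⟩

end LeCam

/-!
The proof is Stein's method. One pair of kernels serves every `r₀`: smoothing, which sends `k` to
the uniform law on `(k - 1/2, k + 1/2]`, and rounding to the nearest natural number. Rounding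
undoes smoothing, so both deficiencies are controlled by the distance between the smoothed negative
binomial law `W` and the normal law `Q` with the same mean `μ` and variance `s ^ 2 = r p / q ^ 2`
(`abs_real_bind_sub_real_gaussianReal_le`); this distance is `O(1 / s)`.

For a continuous `h` with values in `[0, 1]`, the equation
`s ^ 2 g' x - (x - μ) g x = s ^ 2 (h x - ∫ h dQ)`
has a solution with `g = O(s)` and `|g'| ≤ 2` (`exists_stein_solution_gaussianReal`).
Integrated over the cell around `k`, the term in `g'` becomes the exact increment
`g (k + 1/2) - g (k - 1/2)`. The recurrence `(k + 1) π (k + 1) = p (r + k) π k` of the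
mass function `π` gives, by summation by parts, a discrete Stein identity for `G k = g (k - 1/2)`
(`hasSum_stein_negBinPMFReal`). Adding the two cancels the main terms. What is left in each cell is
at most a constant times `|k - μ| + s`, so its expectation is `O(s)`, and division by `s ^ 2` gives
the rate (`integral_sub_integral_gaussianReal_le`). Continuous test functions determine the total
variation because finite measures on the line are inner regular
(`real_sub_real_le_of_forall_continuous`).
-/

namespace LeCam

/-! ### Stein's equation for the normal law -/

/-- The Mills ratio bound: the Gaussian density dominates `y` times its tail at `y`. -/
theorem mul_integral_Ioi_exp_le (y : ℝ) :
    y * ∫ t in Set.Ioi y, Real.exp (-(1 / 2) * t ^ 2) ≤ Real.exp (-(1 / 2) * y ^ 2) := by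
  have hb : (0 : ℝ) < 1 / 2 := by norm_num
  have h1 : ∫ t in Set.Ioi y, t * Real.exp (-(1 / 2) * t ^ 2) = Real.exp (-(1 / 2) * y ^ 2) := by
    have hd : ∀ x : ℝ, HasDerivAt (fun t : ℝ ↦ -Real.exp (-(1 / 2) * t ^ 2))
        (x * Real.exp (-(1 / 2) * x ^ 2)) x := by
      intro x
      have h := (((hasDerivAt_pow 2 x).const_mul (-(1 / 2) : ℝ)).exp).neg
      convert! h using 1
      ring
    have hlim : Filter.Tendsto (fun t : ℝ ↦ -Real.exp (-(1 / 2) * t ^ 2)) Filter.atTop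
        (nhds (-0)) := by
      refine (Real.tendsto_exp_atBot.comp ?_).neg
      exact (Filter.tendsto_pow_atTop two_ne_zero).const_mul_atTop_of_neg (by norm_num)
    have h := integral_Ioi_of_hasDerivAt_of_tendsto (hd y).continuousAt.continuousWithinAt
      (fun x _ ↦ hd x) (integrable_mul_exp_neg_mul_sq hb).integrableOn hlim
    rw [h]
    ring
  rw [← h1, ← integral_const_mul]
  refine setIntegral_mono_on ((integrable_exp_neg_mul_sq hb).const_mul y).integrableOn
    (integrable_mul_exp_neg_mul_sq hb).integrableOn measurableSet_Ioi fun t ht ↦ ?_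
  exact mul_le_mul_of_nonneg_right (le_of_lt ht) (Real.exp_pos _).le

/-- A bound for the ratio of the tail of the standard normal density to its value at a point
`y ≥ 0`, and hence for the solutions of Stein's equation with right-hand side at most one. The
constant is not optimal. -/
noncomputable def steinConst : ℝ :=
  1 + Real.exp (1 / 2) * ∫ t, Real.exp (-(1 / 2) * t ^ 2)

theorem steinConst_pos : 0 < steinConst := by
  have : 0 ≤ ∫ t, Real.exp (-(1 / 2) * t ^ 2) := integral_nonneg fun t ↦ (Real.exp_pos _).le
  unfold steinConst
  positivity

theorem integral_Ioi_exp_le {y : ℝ} (hy : 0 ≤ y) :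
    ∫ t in Set.Ioi y, Real.exp (-(1 / 2) * t ^ 2) ≤
      steinConst * Real.exp (-(1 / 2) * y ^ 2) := by
  have hb : (0 : ℝ) < 1 / 2 := by norm_num
  set J := ∫ t, Real.exp (-(1 / 2) * t ^ 2) with hJ
  have hJ0 : 0 ≤ J := integral_nonneg fun t ↦ (Real.exp_pos _).le
  have hI0 : 0 ≤ ∫ t in Set.Ioi y, Real.exp (-(1 / 2) * t ^ 2) :=
    integral_nonneg fun t ↦ (Real.exp_pos _).le
  have hE := Real.exp_pos (-(1 / 2) * y ^ 2)
  have hK : steinConst = 1 + Real.exp (1 / 2) * J := rfl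
  rw [hK]
  -- the Mills ratio bound suffices for `y ≥ 1`; below, the tail is at most the total mass
  rcases le_total 1 y with h | h
  · have h1 := mul_integral_Ioi_exp_le y
    have h2 : 0 ≤ Real.exp (1 / 2) * J * Real.exp (-(1 / 2) * y ^ 2) := by positivity
    nlinarith
  · have h1 : ∫ t in Set.Ioi y, Real.exp (-(1 / 2) * t ^ 2) ≤ J :=
      setIntegral_le_integral (integrable_exp_neg_mul_sq hb)
        (Filter.Eventually.of_forall fun t ↦ (Real.exp_pos _).le)
    have h2 : 1 ≤ Real.exp (1 / 2) * Real.exp (-(1 / 2) * y ^ 2) := by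
      rw [← Real.exp_add]
      exact Real.one_le_exp (by nlinarith)
    nlinarith [mul_le_mul_of_nonneg_left h2 hJ0]

/-- Stein's equation `f' y - y f y = D y` for a continuous `D` with `|D| ≤ 1` that is centred under
the standard normal law has a solution with `f` and `y ↦ y f y` bounded. -/
theorem exists_stein_solution {D : ℝ → ℝ} (hD : Continuous D) (hD1 : ∀ y, |D y| ≤ 1)
    (hD0 : ∫ t, D t * Real.exp (-(1 / 2) * t ^ 2) = 0) :
    ∃ f : ℝ → ℝ, (∀ y, HasDerivAt f (y * f y + D y) y) ∧ (∀ y, |f y| ≤ steinConst) ∧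
      ∀ y, |y * f y| ≤ 1 := by
  have hb : (0 : ℝ) < 1 / 2 := by norm_num
  have hwi := integrable_exp_neg_mul_sq hb
  have hwc : Continuous fun t : ℝ ↦ Real.exp (-(1 / 2) * t ^ 2) := by fun_prop
  set w : ℝ → ℝ := fun t ↦ Real.exp (-(1 / 2) * t ^ 2) with hw
  have hwpos : ∀ t, 0 < w t := fun t ↦ Real.exp_pos _
  have hgc : Continuous fun t ↦ D t * w t := hD.mul hwc
  have hle : ∀ t, ‖D t * w t‖ ≤ w t := fun t ↦ by
    rw [norm_mul, Real.norm_eq_abs, Real.norm_eq_abs, abs_of_pos (hwpos t)]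
    exact mul_le_of_le_one_left (hwpos t).le (hD1 t)
  have hgi : Integrable fun t ↦ D t * w t :=
    hwi.mono' hgc.aestronglyMeasurable (Filter.Eventually.of_forall hle)
  set F : ℝ → ℝ := fun y ↦ ∫ t in Set.Iic y, D t * w t with hF
  have hFd : ∀ y, HasDerivAt F (D y * w y) y := by
    intro y
    have h1 : F = fun y ↦ F 0 + ∫ t in (0 : ℝ)..y, D t * w t := by
      funext y
      rw [← intervalIntegral.integral_Iic_sub_Iic hgi.integrableOn hgi.integrableOn]
      simp [hF]
    rw [h1]
    exact (intervalIntegral.integral_hasDerivAt_right (hgc.intervalIntegrable _ _)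
      hgc.aestronglyMeasurable.stronglyMeasurableAtFilter hgc.continuousAt).const_add _
  have hFabs : ∀ y, |F y| ≤ ∫ t in Set.Ioi |y|, w t := by
    intro y
    rcases le_total 0 y with h | h
    -- for `y ≥ 0` centring allows the use of the upper tail in place of the lower one
    · have h1 : F y = -∫ t in Set.Ioi y, D t * w t := by
        have := intervalIntegral.integral_Iic_add_Ioi (b := y) hgi.integrableOn hgi.integrableOn
        rw [hD0] at this
        exact eq_neg_of_add_eq_zero_left this
      rw [abs_of_nonneg h, h1, abs_neg]
      exact norm_integral_le_of_norm_le hwi.integrableOn (Filter.Eventually.of_forall hle)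
    · have h1 : ∫ t in Set.Ioi (-y), w t = ∫ t in Set.Iic y, w t := by
        rw [← integral_comp_neg_Iic]
        simp [hw]
      rw [abs_of_nonpos h, h1]
      exact norm_integral_le_of_norm_le hwi.integrableOn (Filter.Eventually.of_forall hle)
  have hinv : ∀ y, (w y)⁻¹ * w |y| = 1 := fun y ↦ by
    have : w |y| = w y := by simp [hw]
    rw [this, inv_mul_cancel₀ (hwpos y).ne']
  -- multiplying by the integrating factor `w` turns the equation into `F' = D w`
  refine ⟨fun y ↦ (w y)⁻¹ * F y, fun y ↦ ?_, fun y ↦ ?_, fun y ↦ ?_⟩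
  · have h1 : HasDerivAt w (-(y * w y)) y := by
      have h := ((hasDerivAt_pow 2 y).const_mul (-(1 / 2) : ℝ)).exp
      convert! h using 1
      simp [hw]
      ring
    have h2 := (h1.inv (hwpos y).ne').mul (hFd y)
    convert! h2 using 1
    have := (hwpos y).ne'
    simp only [Pi.inv_apply]
    field_simp
  · rw [abs_mul, abs_of_pos (inv_pos.2 (hwpos y))]
    calc (w y)⁻¹ * |F y| ≤ (w y)⁻¹ * (steinConst * w |y|) :=
          mul_le_mul_of_nonneg_left ((hFabs y).trans (integral_Ioi_exp_le (abs_nonneg y)))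
            (inv_pos.2 (hwpos y)).le
      _ = steinConst := by rw [mul_left_comm, hinv, mul_one]
  · rw [abs_mul, abs_mul, abs_of_pos (inv_pos.2 (hwpos y))]
    calc |y| * ((w y)⁻¹ * |F y|) ≤ |y| * ((w y)⁻¹ * ∫ t in Set.Ioi |y|, w t) := by
          have := (inv_pos.2 (hwpos y)).le
          gcongr
          exact hFabs y
      _ = (w y)⁻¹ * (|y| * ∫ t in Set.Ioi |y|, w t) := by ring
      _ ≤ (w y)⁻¹ * w |y| :=
          mul_le_mul_of_nonneg_left (mul_integral_Ioi_exp_le |y|) (inv_pos.2 (hwpos y)).le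
      _ = 1 := hinv y

theorem gaussianReal_map_standard (m s : ℝ) :
    (gaussianReal 0 1).map (fun y ↦ s * y + m) = gaussianReal m (Real.toNNReal (s ^ 2)) := by
  have : (fun y : ℝ ↦ s * y + m) = (fun y ↦ y + m) ∘ fun y ↦ s * y := rfl
  rw [this, ← Measure.map_map (by fun_prop) (by fun_prop), gaussianReal_map_const_mul,
    gaussianReal_map_add_const]
  congr 1
  · simp
  · ext
    simp [Real.coe_toNNReal _ (sq_nonneg s)]

/-- Stein's equation for the normal law with mean `m` and variance `s ^ 2`, with a test function `h`
between zero and one. -/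
theorem exists_stein_solution_gaussianReal (m : ℝ) {s : ℝ} (hs : 0 < s) {h : ℝ → ℝ}
    (hc : Continuous h) (h0 : ∀ x, 0 ≤ h x) (h1 : ∀ x, h x ≤ 1) :
    ∃ g g' : ℝ → ℝ, (∀ x, HasDerivAt g (g' x) x) ∧
      (∀ x, s ^ 2 * g' x - (x - m) * g x =
        s ^ 2 * (h x - ∫ z, h z ∂gaussianReal m (Real.toNNReal (s ^ 2)))) ∧
      (∀ x, |g x| ≤ steinConst * s) ∧ ∀ x, |g' x| ≤ 2 := by
  set H : ℝ → ℝ := fun y ↦ h (s * y + m) with hH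
  have hHc : Continuous H := by fun_prop
  have hHi : Integrable H (gaussianReal 0 1) :=
    (integrable_const (1 : ℝ)).mono' hHc.aestronglyMeasurable
      (Filter.Eventually.of_forall fun y ↦ by
        rw [Real.norm_eq_abs, abs_of_nonneg (h0 _)]
        exact h1 _)
  set N : ℝ := ∫ z, h z ∂gaussianReal m (Real.toNNReal (s ^ 2)) with hN
  have hNH : N = ∫ y, H y ∂gaussianReal 0 1 := by
    rw [hN, ← gaussianReal_map_standard m s,
      integral_map (by fun_prop) hc.aestronglyMeasurable]
  have hN0 : 0 ≤ N := integral_nonneg h0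
  have hN1 : N ≤ 1 := by
    rw [hNH]
    calc ∫ y, H y ∂gaussianReal 0 1 ≤ ∫ _, (1 : ℝ) ∂gaussianReal 0 1 :=
          integral_mono hHi (integrable_const 1) fun y ↦ h1 _
      _ = 1 := by simp
  have hD1 : ∀ y, |H y - N| ≤ 1 := fun y ↦ by
    have := h0 (s * y + m)
    have := h1 (s * y + m)
    rw [abs_le]
    constructor <;> simp only [hH] <;> linarith
  have hD0 : ∫ t, (H t - N) * Real.exp (-(1 / 2) * t ^ 2) = 0 := by
    have h2 : ∫ y, (H y - N) ∂gaussianReal 0 1 = 0 := by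
      rw [integral_sub hHi (integrable_const N), ← hNH]
      simp
    rw [integral_gaussianReal_eq_integral_smul one_ne_zero] at h2
    have h3 : ∀ t, gaussianPDFReal 0 1 t • (H t - N) =
        (√(2 * Real.pi))⁻¹ * ((H t - N) * Real.exp (-(1 / 2) * t ^ 2)) := fun t ↦ by
      simp only [gaussianPDFReal, smul_eq_mul, NNReal.coe_one, mul_one, sub_zero]
      rw [show -t ^ 2 / 2 = -(1 / 2) * t ^ 2 by ring]
      ring
    simp_rw [h3] at h2
    rw [integral_const_mul] at h2
    refine (mul_eq_zero.1 h2).resolve_left ?_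
    positivity
  obtain ⟨f, hfd, hfK, hf1⟩ := exists_stein_solution (hHc.sub continuous_const) hD1 hD0
  have hHx : ∀ x, H ((x - m) / s) = h x := fun x ↦ by
    simp only [hH]
    congr 1
    field_simp
    ring
  refine ⟨fun x ↦ s * f ((x - m) / s),
    fun x ↦ (x - m) / s * f ((x - m) / s) + (H ((x - m) / s) - N), fun x ↦ ?_, fun x ↦ ?_,
    fun x ↦ ?_, fun x ↦ ?_⟩
  · have h2 : HasDerivAt (fun x : ℝ ↦ (x - m) / s) (1 / s) x :=
      ((hasDerivAt_id x).sub_const m).div_const s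
    have h3 := ((hfd ((x - m) / s)).comp x h2).const_mul s
    convert! h3 using 1
    simp only [Pi.sub_apply, ← hN]
    field_simp
  · simp only [hHx]
    field_simp
    ring
  · rw [abs_mul, abs_of_pos hs, mul_comm]
    exact mul_le_mul_of_nonneg_right (hfK _) hs.le
  · exact (abs_add_le _ _).trans (by linarith [hf1 ((x - m) / s), hD1 ((x - m) / s)])

/-! ### Total variation and continuous test functions -/

/-- Bounding the discrepancy on closed sets suffices for all measurable sets, by inner
regularity, and closed sets are limits of continuous functions. -/
theorem real_sub_real_le_of_forall_continuous {μ ν : Measure ℝ} [IsFiniteMeasure μ]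
    [IsFiniteMeasure ν] {C : ℝ}
    (H : ∀ h : ℝ → ℝ, Continuous h → (∀ x, 0 ≤ h x) → (∀ x, h x ≤ 1) →
      ∫ x, h x ∂μ - ∫ x, h x ∂ν ≤ C) {A : Set ℝ} (hA : MeasurableSet A) :
    μ.real A - ν.real A ≤ C := by
  have hclosed : ∀ F : Set ℝ, IsClosed F → μ.real F - ν.real F ≤ C := by
    intro F hF
    have hpos : ∀ n : ℕ, 0 < 1 / ((n : ℝ) + 1) := fun n ↦ by positivity
    have hlim := tendsto_one_div_add_atTop_nhds_zero_nat (𝕜 := ℝ)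
    refine le_of_tendsto ((tendsto_integral_thickenedIndicator_of_isClosed μ hF hpos hlim).sub
      (tendsto_integral_thickenedIndicator_of_isClosed ν hF hpos hlim))
      (Filter.Eventually.of_forall fun n ↦ ?_)
    refine H _ ?_ (fun x ↦ NNReal.coe_nonneg _) fun x ↦ ?_
    · exact NNReal.continuous_coe.comp (thickenedIndicator (hpos n) F).continuous
    · exact_mod_cast thickenedIndicator_le_one (hpos n) F x
  refine le_of_forall_pos_le_add fun ε hε ↦ ?_
  obtain ⟨F, hFA, hF, hlt⟩ := hA.exists_isClosed_lt_add (measure_ne_top μ A)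
    (ε := ENNReal.ofReal ε) (by simpa using hε)
  have h1 : μ.real A ≤ μ.real F + ε := by
    have := ENNReal.toReal_mono (by finiteness) hlt.le
    rwa [ENNReal.toReal_add (by finiteness) (by finiteness), ENNReal.toReal_ofReal hε.le] at this
  have h2 : ν.real F ≤ ν.real A := measureReal_mono hFA
  linarith [hclosed F hF]

theorem tvNorm_le_of_forall_real_sub_le {X : Type*} [MeasurableSpace X] {μ ν : Measure X}
    [IsFiniteMeasure μ] [IsFiniteMeasure ν] {C : ℝ}
    (H : ∀ A, MeasurableSet A → |μ.real A - ν.real A| ≤ C) :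
    tvNorm μ ν ≤ ENNReal.ofReal (2 * C) := by
  set s := μ.toSignedMeasure - ν.toSignedMeasure with hs
  have hsA : ∀ A, MeasurableSet A → s A = μ.real A - ν.real A := fun A hA ↦ by
    rw [hs, sub_apply, Measure.toSignedMeasure_apply_measurable hA,
      Measure.toSignedMeasure_apply_measurable hA]
  obtain ⟨i, hi, hi0, hi1, hp, hn⟩ := s.toJordanDecomposition_spec
  have hC : 0 ≤ C := (abs_nonneg _).trans (H Set.univ MeasurableSet.univ)
  rw [tvNorm, SignedMeasure.totalVariation, Measure.add_apply, hp, hn, two_mul,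
    ENNReal.ofReal_add hC hC]
  rw [SignedMeasure.toMeasureOfZeroLE_apply _ _ _ MeasurableSet.univ,
    SignedMeasure.toMeasureOfLEZero_apply _ _ _ MeasurableSet.univ]
  simp only [Set.inter_univ]
  gcongr
  · rw [← ENNReal.ofReal_coe_nnreal]
    refine ENNReal.ofReal_le_ofReal ?_
    rw [NNReal.coe_mk, hsA _ hi]
    exact (le_abs_self _).trans (H _ hi)
  · rw [← ENNReal.ofReal_coe_nnreal]
    refine ENNReal.ofReal_le_ofReal ?_
    rw [NNReal.coe_mk, hsA _ hi.compl]
    exact (neg_le_abs _).trans (H _ hi.compl)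

/-! ### Moments and summation by parts for the negative binomial law -/

theorem negBinPMFReal_succ {r : ℝ} (hr : 0 < r) (p : ℝ) (k : ℕ) :
    (k + 1 : ℝ) * negBinPMFReal r p (k + 1) = p * (r + k) * negBinPMFReal r p k := by
  have hG : Real.Gamma r ≠ 0 := (Real.Gamma_pos_of_pos hr).ne'
  have hk : (k ! : ℝ) ≠ 0 := by positivity
  have hk1 : (k + 1 : ℝ) ≠ 0 := by positivity
  have h : Real.Gamma (r + (k + 1 : ℕ)) = (r + k) * Real.Gamma (r + k) := by
    rw [Nat.cast_succ, ← add_assoc, Real.Gamma_add_one (by positivity)]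
  rw [negBinPMFReal, negBinPMFReal, h, Nat.factorial_succ]
  push_cast
  field_simp
  ring

/-- Size-biasing the negative binomial law with parameter `r` gives, up to a shift, the law with
parameter `r + 1`. -/
theorem negBinPMFReal_succ_eq_add_one {r p : ℝ} (hr : 0 < r) (hp : p ∈ Set.Ioo (0 : ℝ) 1) (k : ℕ) :
    (k + 1 : ℝ) * negBinPMFReal r p (k + 1) = r * p / (1 - p) * negBinPMFReal (r + 1) p k := by
  have hG : Real.Gamma r ≠ 0 := (Real.Gamma_pos_of_pos hr).ne'
  have hk : (k ! : ℝ) ≠ 0 := by positivity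
  have hq : 0 < 1 - p := sub_pos.2 hp.2
  have h : Real.Gamma (r + 1 + k) = (r + k) * Real.Gamma (r + k) := by
    rw [add_right_comm, Real.Gamma_add_one (by positivity)]
  rw [negBinPMFReal_succ hr, negBinPMFReal, negBinPMFReal, h, Real.Gamma_add_one hr.ne',
    Real.rpow_add_one hq.ne']
  field_simp

theorem hasSum_mul_negBinPMFReal {r p : ℝ} (hr : 0 < r) (hp : p ∈ Set.Ioo (0 : ℝ) 1) :
    HasSum (fun k : ℕ ↦ (k : ℝ) * negBinPMFReal r p k) (r * p / (1 - p)) := by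
  have h := (hasSum_negBinPMFReal (r := r + 1) (by linarith) hp).mul_left (r * p / (1 - p))
  simp_rw [← negBinPMFReal_succ_eq_add_one hr hp] at h
  rw [← hasSum_nat_add_iff' 1]
  simpa using h

theorem hasSum_mul_sub_one_mul_negBinPMFReal {r p : ℝ} (hr : 0 < r)
    (hp : p ∈ Set.Ioo (0 : ℝ) 1) :
    HasSum (fun k : ℕ ↦ (k : ℝ) * (k - 1) * negBinPMFReal r p k)
      (r * p / (1 - p) * ((r + 1) * p / (1 - p))) := by
  have h := (hasSum_mul_negBinPMFReal (r := r + 1) (by linarith) hp).mul_left (r * p / (1 - p))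
  rw [← hasSum_nat_add_iff' 1]
  convert! h using 1
  · funext k
    rw [mul_left_comm, ← negBinPMFReal_succ_eq_add_one hr hp]
    push_cast
    ring
  · simp

theorem hasSum_sub_sq_mul_negBinPMFReal {r p : ℝ} (hr : 0 < r) (hp : p ∈ Set.Ioo (0 : ℝ) 1) :
    HasSum (fun k : ℕ ↦ ((k : ℝ) - r * p / (1 - p)) ^ 2 * negBinPMFReal r p k)
      (r * p / (1 - p) ^ 2) := by
  have hq : (1 - p) ≠ 0 := (sub_pos.2 hp.2).ne'
  have h := ((hasSum_mul_sub_one_mul_negBinPMFReal hr hp).add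
    ((hasSum_mul_negBinPMFReal hr hp).mul_left (1 - 2 * (r * p / (1 - p))))).add
    ((hasSum_negBinPMFReal hr hp).mul_left ((r * p / (1 - p)) ^ 2))
  convert! h using 1
  · funext k
    ring
  · field_simp
    ring

theorem summable_abs_sub_mul_negBinPMFReal {r p : ℝ} (hr : 0 < r) (hp : p ∈ Set.Ioo (0 : ℝ) 1)
    (c : ℝ) : Summable fun k : ℕ ↦ |(k : ℝ) - c| * negBinPMFReal r p k := by
  have h := ((hasSum_mul_negBinPMFReal hr hp).sub
    ((hasSum_negBinPMFReal hr hp).mul_left c)).summable.abs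
  refine h.congr fun k ↦ ?_
  rw [← sub_mul, abs_mul, abs_of_nonneg (negBinPMFReal_nonneg hr hp k)]

/-- The mean absolute deviation of the negative binomial law is at most its standard deviation. -/
theorem tsum_abs_sub_mul_negBinPMFReal_le {r p s : ℝ} (hr : 0 < r) (hp : p ∈ Set.Ioo (0 : ℝ) 1)
    (hs : 0 < s) (hs2 : s ^ 2 = r * p / (1 - p) ^ 2) :
    ∑' k : ℕ, |(k : ℝ) - r * p / (1 - p)| * negBinPMFReal r p k ≤ s := by
  have h := ((hasSum_sub_sq_mul_negBinPMFReal hr hp).mul_left ((2 * s)⁻¹)).add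
    ((hasSum_negBinPMFReal hr hp).mul_left (s / 2))
  have he : (2 * s)⁻¹ * (r * p / (1 - p) ^ 2) + s / 2 * 1 = s := by
    rw [← hs2]
    field_simp
    ring
  rw [he] at h
  refine hasSum_le (fun k ↦ ?_) (summable_abs_sub_mul_negBinPMFReal hr hp _).hasSum h
  rw [← mul_assoc, ← add_mul]
  refine mul_le_mul_of_nonneg_right ?_ (negBinPMFReal_nonneg hr hp k)
  rw [← sq_abs ((k : ℝ) - r * p / (1 - p))]
  set a := |(k : ℝ) - r * p / (1 - p)|
  -- the inequality of arithmetic and geometric means for `a ^ 2 / s` and `s`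
  have : (2 * s)⁻¹ * a ^ 2 + s / 2 - a = (2 * s)⁻¹ * (a - s) ^ 2 := by
    field_simp
    ring
  have : 0 ≤ (2 * s)⁻¹ * (a - s) ^ 2 := by positivity
  linarith

/-- Summation by parts against the negative binomial law: with `μ` the mean and
`s ^ 2 = r p / q ^ 2` the variance, `(k - μ) G k` has the same expectation as
`(s ^ 2 + (p / q) (k - μ)) (G (k + 1) - G k)`. -/
theorem hasSum_stein_negBinPMFReal {r p s : ℝ} (hr : 0 < r) (hp : p ∈ Set.Ioo (0 : ℝ) 1)
    (hs2 : s ^ 2 = r * p / (1 - p) ^ 2) {G : ℕ → ℝ} {C : ℝ} (hG : ∀ k, |G k| ≤ C) :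
    HasSum (fun k : ℕ ↦ (((k : ℝ) - r * p / (1 - p)) * G k -
      (s ^ 2 + p / (1 - p) * ((k : ℝ) - r * p / (1 - p))) * (G (k + 1) - G k)) *
        negBinPMFReal r p k) 0 := by
  have hq : (1 - p) ≠ 0 := (sub_pos.2 hp.2).ne'
  set a : ℕ → ℝ := fun k ↦ (k : ℝ) * negBinPMFReal r p k * G k with ha
  have hsum : Summable a := by
    refine ((hasSum_mul_negBinPMFReal hr hp).summable.mul_right C).of_norm_bounded fun k ↦ ?_
    have h0 : 0 ≤ (k : ℝ) * negBinPMFReal r p k :=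
      mul_nonneg (Nat.cast_nonneg k) (negBinPMFReal_nonneg hr hp k)
    rw [ha, norm_mul, Real.norm_eq_abs, Real.norm_eq_abs, abs_of_nonneg h0]
    exact mul_le_mul_of_nonneg_left (hG k) h0
  have h1 : HasSum (fun k ↦ a (k + 1)) (∑' k, a k) := by
    rw [hasSum_nat_add_iff 1]
    simpa [ha] using hsum.hasSum
  have h2 := (hsum.hasSum.sub h1).mul_left (1 / (1 - p))
  rw [sub_self, mul_zero] at h2
  convert! h2 using 1
  funext k
  have h3 := negBinPMFReal_succ hr p k
  have h4 : a (k + 1) = p * (r + k) * negBinPMFReal r p k * G (k + 1) := by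
    simp only [ha]
    rw [← h3]
    push_cast
    ring
  rw [h4, hs2]
  simp only [ha]
  field_simp
  ring

/-! ### Smoothing and rounding kernels -/

/-- The Markov kernel sending `k` to the uniform law on the interval `(k - 1/2, k + 1/2]`. -/
noncomputable def smoothingKernel : Kernel ℕ ℝ :=
  ⟨fun k ↦ volume.restrict (Set.Ioc ((k : ℝ) - 1 / 2) (k + 1 / 2)), measurable_from_nat⟩

theorem smoothingKernel_apply (k : ℕ) :
    smoothingKernel k = volume.restrict (Set.Ioc ((k : ℝ) - 1 / 2) (k + 1 / 2)) := rfl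

instance isMarkovKernel_smoothingKernel : IsMarkovKernel smoothingKernel := by
  refine ⟨fun k ↦ ⟨?_⟩⟩
  rw [smoothingKernel_apply, Measure.restrict_apply_univ, Real.volume_Ioc]
  norm_num

/-- Rounding a real number to the nearest natural number (halves are rounded down, negative
numbers go to zero). -/
noncomputable def roundNat (x : ℝ) : ℕ := ⌈x - 1 / 2⌉₊

theorem measurable_roundNat : Measurable roundNat :=
  Nat.measurable_ceil.comp (measurable_id.sub_const _)

theorem roundNat_eq {k : ℕ} {x : ℝ} (hx : x ∈ Set.Ioc ((k : ℝ) - 1 / 2) (k + 1 / 2)) :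
    roundNat x = k := by
  refine le_antisymm (Nat.ceil_le.2 (by linarith [hx.2])) ?_
  rcases Nat.eq_zero_or_pos k with rfl | hk
  · exact Nat.zero_le _
  · have h1 : k - 1 < ⌈x - 1 / 2⌉₊ := Nat.lt_ceil.2 (by
      rw [Nat.cast_sub hk]
      push_cast
      linarith [hx.1])
    unfold roundNat
    omega

theorem map_roundNat_smoothingKernel (k : ℕ) :
    (smoothingKernel k).map roundNat = Measure.dirac k := by
  have h : roundNat =ᵐ[smoothingKernel k] fun _ ↦ k := by
    rw [smoothingKernel_apply]
    exact (ae_restrict_mem measurableSet_Ioc).mono fun x hx ↦ roundNat_eq hx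
  rw [Measure.map_congr h, Measure.map_const, measure_univ, one_smul]

theorem bind_smoothingKernel_negBinMeasure (r p : ℝ) :
    (negBinMeasure r p).bind smoothingKernel =
      Measure.sum fun k ↦ ENNReal.ofReal (negBinPMFReal r p k) • smoothingKernel k := by
  ext A hA
  rw [Measure.bind_apply hA smoothingKernel.aemeasurable, negBinMeasure, lintegral_sum_measure,
    Measure.sum_apply _ hA]
  simp

/-- Rounding undoes smoothing. -/
theorem map_roundNat_bind_smoothingKernel (μ : Measure ℕ) :
    (μ.bind smoothingKernel).map roundNat = μ := by
  ext A hA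
  rw [Measure.map_apply measurable_roundNat hA,
    Measure.bind_apply (measurable_roundNat hA) smoothingKernel.aemeasurable]
  simp_rw [← Measure.map_apply measurable_roundNat hA, map_roundNat_smoothingKernel,
    Measure.dirac_apply' _ hA]
  rw [lintegral_indicator_one hA]

theorem hasSum_integral_bind_smoothingKernel {r p : ℝ} (hr : 0 < r) (hp : p ∈ Set.Ioo (0 : ℝ) 1)
    {h : ℝ → ℝ} (hc : Continuous h) (h0 : ∀ x, 0 ≤ h x) (h1 : ∀ x, h x ≤ 1) :
    HasSum (fun k : ℕ ↦ (∫ x in (k - 1 / 2 : ℝ)..(k + 1 / 2), h x) * negBinPMFReal r p k)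
      (∫ x, h x ∂(negBinMeasure r p).bind smoothingKernel) := by
  have := isProbabilityMeasure_negBinMeasure hr hp
  have hi : Integrable h ((negBinMeasure r p).bind smoothingKernel) :=
    (integrable_const (1 : ℝ)).mono' hc.aestronglyMeasurable
      (Filter.Eventually.of_forall fun y ↦ by
        rw [Real.norm_eq_abs, abs_of_nonneg (h0 _)]
        exact h1 _)
  rw [bind_smoothingKernel_negBinMeasure] at hi ⊢
  convert! hasSum_integral_measure hi using 1
  funext k
  rw [integral_smul_measure, ENNReal.toReal_ofReal (negBinPMFReal_nonneg hr hp k), smul_eq_mul,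
    smoothingKernel_apply, intervalIntegral.integral_of_le (by linarith), mul_comm]

/-! ### Comparison of the smoothed negative binomial law with the normal law -/

/-- The numerator in the bound `approxConst p / s` for the distance, over measurable sets, between
the smoothed negative binomial law and the normal law with the same mean and variance `s ^ 2`. -/
noncomputable def approxConst (p : ℝ) : ℝ := 2 + steinConst + 2 * (p / (1 - p))

/-- In the cell around `k`, the discrete and the integrated form of the linear term in Stein's
identity differ by a quantity that is of the order of the standard deviation on average. -/
theorem abs_cell_le {g g' : ℝ → ℝ} (hd : ∀ x, HasDerivAt g (g' x) x) {K : ℝ}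
    (hg : ∀ x, |g x| ≤ K) (hg' : ∀ x, |g' x| ≤ 2) (m : ℝ) (k : ℕ) :
    |((k : ℝ) - m) * g (k - 1 / 2) - ∫ x in (k - 1 / 2 : ℝ)..(k + 1 / 2), (x - m) * g x| ≤
      2 * |(k : ℝ) - m| + K := by
  have hgc : Continuous g := continuous_iff_continuousAt.2 fun x ↦ (hd x).continuousAt
  have h1 : ((k : ℝ) - m) * g (k - 1 / 2) - ∫ x in (k - 1 / 2 : ℝ)..(k + 1 / 2), (x - m) * g x =
      ∫ x in (k - 1 / 2 : ℝ)..(k + 1 / 2), (((k : ℝ) - m) * g (k - 1 / 2) - (x - m) * g x) := by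
    rw [intervalIntegral.integral_sub (by simp)
      (Continuous.intervalIntegrable (by fun_prop) _ _), intervalIntegral.integral_const]
    norm_num
  rw [h1]
  have h2 := intervalIntegral.norm_integral_le_of_norm_le_const (a := (k - 1 / 2 : ℝ))
    (b := k + 1 / 2) (C := 2 * |(k : ℝ) - m| + K)
    (f := fun x ↦ ((k : ℝ) - m) * g (k - 1 / 2) - (x - m) * g x) fun x hx ↦ ?_
  · refine h2.trans_eq ?_
    norm_num
  rw [Set.uIoc_of_le (by linarith)] at hx
  have h3 : |g x - g (k - 1 / 2)| ≤ 2 := by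
    have := Convex.norm_image_sub_le_of_norm_hasDerivWithin_le (s := Set.univ)
      (x := (k - 1 / 2 : ℝ)) (y := x) (fun x _ ↦ (hd x).hasDerivWithinAt) (fun x _ ↦ hg' x)
      convex_univ trivial trivial
    rw [Real.norm_eq_abs, Real.norm_eq_abs,
      abs_of_nonneg (a := x - (k - 1 / 2 : ℝ)) (by linarith [hx.1])] at this
    linarith [hx.2]
  have h4 : |(k : ℝ) - x| ≤ 1 := abs_le.2 ⟨by linarith [hx.2], by linarith [hx.1]⟩
  have h5 : ((k : ℝ) - m) * g (k - 1 / 2) - (x - m) * g x =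
      -(((k : ℝ) - m) * (g x - g (k - 1 / 2))) + (k - x) * g x := by ring
  rw [h5, Real.norm_eq_abs]
  refine (abs_add_le _ _).trans ?_
  rw [abs_neg, abs_mul, abs_mul, mul_comm 2]
  have h6 := mul_le_mul_of_nonneg_left h3 (abs_nonneg ((k : ℝ) - m))
  have h7 := mul_le_mul h4 (hg x) (abs_nonneg _) zero_le_one
  linarith

/-- The normal approximation, tested on continuous functions. Stein's equation is integrated over
each cell, and summation by parts against the negative binomial law cancels the main terms. -/
theorem integral_sub_integral_gaussianReal_le {r p s : ℝ} (hr : 0 < r)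
    (hp : p ∈ Set.Ioo (0 : ℝ) 1) (hs : 0 < s) (hs2 : s ^ 2 = r * p / (1 - p) ^ 2) {h : ℝ → ℝ}
    (hc : Continuous h) (h0 : ∀ x, 0 ≤ h x) (h1 : ∀ x, h x ≤ 1) :
    |∫ x, h x ∂(negBinMeasure r p).bind smoothingKernel -
      ∫ x, h x ∂gaussianReal (r * p / (1 - p)) (Real.toNNReal (s ^ 2))| ≤ approxConst p / s := by
  have hq : 0 < 1 - p := sub_pos.2 hp.2
  set m := r * p / (1 - p) with hm
  set N := ∫ x, h x ∂gaussianReal m (Real.toNNReal (s ^ 2)) with hN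
  obtain ⟨g, g', hd, heq, hg, hg'⟩ := exists_stein_solution_gaussianReal m hs hc h0 h1
  have hgc : Continuous g := continuous_iff_continuousAt.2 fun x ↦ (hd x).continuousAt
  have hcell : ∀ k : ℕ, s ^ 2 * ((∫ x in (k - 1 / 2 : ℝ)..(k + 1 / 2), h x) - N) =
      s ^ 2 * (g (k + 1 / 2) - g (k - 1 / 2)) -
        ∫ x in (k - 1 / 2 : ℝ)..(k + 1 / 2), (x - m) * g x := by
    intro k
    have hgeq : ∀ x, g' x = (h x - N) + (s ^ 2)⁻¹ * ((x - m) * g x) := fun x ↦ by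
      have := heq x
      field_simp
      linarith
    have hF := intervalIntegral.integral_eq_sub_of_hasDerivAt (a := (k - 1 / 2 : ℝ))
      (b := k + 1 / 2) (fun x _ ↦ hd x) (by
        rw [funext hgeq]
        exact Continuous.intervalIntegrable (by fun_prop) _ _)
    rw [← hF, funext hgeq,
      intervalIntegral.integral_add (Continuous.intervalIntegrable (by fun_prop) _ _)
      (Continuous.intervalIntegrable (by fun_prop) _ _),
      intervalIntegral.integral_sub (hc.intervalIntegrable _ _) (by simp),
      intervalIntegral.integral_const, intervalIntegral.integral_const_mul]
    field_simp
    norm_num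
  have hsum := (((hasSum_integral_bind_smoothingKernel hr hp hc h0 h1).sub
    ((hasSum_negBinPMFReal hr hp).mul_left N)).mul_left (s ^ 2)).add
    (hasSum_stein_negBinPMFReal hr hp hs2 (G := fun k : ℕ ↦ g (k - 1 / 2)) fun k ↦ hg _)
  rw [mul_one, add_zero, ← hm] at hsum
  have hterm : ∀ k : ℕ, s ^ 2 * ((∫ x in (k - 1 / 2 : ℝ)..(k + 1 / 2), h x) *
      negBinPMFReal r p k - N * negBinPMFReal r p k) +
      (((k : ℝ) - m) * g (k - 1 / 2) - (s ^ 2 + p / (1 - p) * ((k : ℝ) - m)) *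
        (g ((k + 1 : ℕ) - 1 / 2) - g (k - 1 / 2))) * negBinPMFReal r p k =
      (((k : ℝ) - m) * g (k - 1 / 2) - (∫ x in (k - 1 / 2 : ℝ)..(k + 1 / 2), (x - m) * g x) -
        p / (1 - p) * ((k : ℝ) - m) * (g (k + 1 / 2) - g (k - 1 / 2))) *
          negBinPMFReal r p k := by
    intro k
    have h2 : (((k + 1 : ℕ) : ℝ) - 1 / 2) = k + 1 / 2 := by
      push_cast
      ring
    rw [h2]
    linear_combination negBinPMFReal r p k * hcell k
  rw [funext hterm] at hsum
  have hbd : ∀ k : ℕ, ‖(((k : ℝ) - m) * g (k - 1 / 2) -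
      (∫ x in (k - 1 / 2 : ℝ)..(k + 1 / 2), (x - m) * g x) -
        p / (1 - p) * ((k : ℝ) - m) * (g (k + 1 / 2) - g (k - 1 / 2))) *
          negBinPMFReal r p k‖ ≤ (2 + 2 * (p / (1 - p))) *
            (|(k : ℝ) - m| * negBinPMFReal r p k) + steinConst * s * negBinPMFReal r p k := by
    intro k
    rw [Real.norm_eq_abs, abs_mul, abs_of_nonneg (negBinPMFReal_nonneg hr hp k), ← mul_assoc,
      ← add_mul]
    refine mul_le_mul_of_nonneg_right ?_ (negBinPMFReal_nonneg hr hp k)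
    have h2 := abs_cell_le hd hg hg' m k
    have h3 : |g (k + 1 / 2) - g (k - 1 / 2)| ≤ 2 := by
      have := Convex.norm_image_sub_le_of_norm_hasDerivWithin_le (s := Set.univ)
        (x := (k - 1 / 2 : ℝ)) (y := k + 1 / 2) (fun x _ ↦ (hd x).hasDerivWithinAt)
        (fun x _ ↦ hg' x) convex_univ trivial trivial
      norm_num at this ⊢
      exact this
    have hp0 : 0 ≤ p / (1 - p) := div_nonneg hp.1.le hq.le
    refine (abs_sub _ _).trans ?_
    rw [abs_mul, abs_mul, abs_of_nonneg hp0]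
    have h4 : p / (1 - p) * |(k : ℝ) - m| * |g (k + 1 / 2) - g (k - 1 / 2)| ≤
        p / (1 - p) * |(k : ℝ) - m| * 2 :=
      mul_le_mul_of_nonneg_left h3 (by positivity)
    linarith
  have hA := summable_abs_sub_mul_negBinPMFReal hr hp m
  have hB := (hA.hasSum.mul_left (2 + 2 * (p / (1 - p)))).add
    ((hasSum_negBinPMFReal hr hp).mul_left (steinConst * s))
  have hle : |s ^ 2 * (∫ x, h x ∂(negBinMeasure r p).bind smoothingKernel - N)| ≤
      approxConst p * s := by
    have h2 := tsum_of_norm_bounded hB hbd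
    rw [hsum.tsum_eq, Real.norm_eq_abs] at h2
    refine h2.trans ?_
    have h3 := tsum_abs_sub_mul_negBinPMFReal_le hr hp hs hs2
    have hp0 : 0 ≤ p / (1 - p) := div_nonneg hp.1.le hq.le
    have h4 := mul_le_mul_of_nonneg_left h3 (by positivity : 0 ≤ 2 + 2 * (p / (1 - p)))
    rw [approxConst]
    linarith
  rw [abs_mul, abs_of_pos (by positivity), sq, mul_assoc] at hle
  rw [le_div_iff₀ hs, mul_comm]
  nlinarith [hle]

theorem abs_real_bind_sub_real_gaussianReal_le {r p s : ℝ} (hr : 0 < r)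
    (hp : p ∈ Set.Ioo (0 : ℝ) 1) (hs : 0 < s) (hs2 : s ^ 2 = r * p / (1 - p) ^ 2) {A : Set ℝ}
    (hA : MeasurableSet A) :
    |((negBinMeasure r p).bind smoothingKernel).real A -
      (gaussianReal (r * p / (1 - p)) (Real.toNNReal (r * p / (1 - p) ^ 2))).real A| ≤
        approxConst p / s := by
  have := isProbabilityMeasure_negBinMeasure hr hp
  rw [← hs2]
  refine abs_sub_le_iff.2 ⟨?_, ?_⟩
  · exact real_sub_real_le_of_forall_continuous (fun h hc h0 h1 ↦ (abs_sub_le_iff.1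
      (integral_sub_integral_gaussianReal_le hr hp hs hs2 hc h0 h1)).1) hA
  · exact real_sub_real_le_of_forall_continuous (fun h hc h0 h1 ↦ (abs_sub_le_iff.1
      (integral_sub_integral_gaussianReal_le hr hp hs hs2 hc h0 h1)).2) hA

theorem approxConst_pos {p : ℝ} (hp : p ∈ Set.Ioo (0 : ℝ) 1) : 0 < approxConst p := by
  have := steinConst_pos
  have : 0 ≤ p / (1 - p) := div_nonneg hp.1.le (sub_pos.2 hp.2).le
  unfold approxConst
  positivity

/-- The reciprocal of the standard deviation is at most its value at the smallest parameter. -/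
theorem two_mul_approxConst_div_sqrt_le {p r r₀ : ℝ} (hp : p ∈ Set.Ioo (0 : ℝ) 1) (hr₀ : 0 < r₀)
    (hr : r₀ ≤ r) :
    2 * (approxConst p / √(r * p / (1 - p) ^ 2)) ≤
      2 * approxConst p * (1 - p) / √p * r₀ ^ (-(1 / 2) : ℝ) := by
  have hq : 0 < 1 - p := sub_pos.2 hp.2
  have hK := approxConst_pos hp
  have hp0 : 0 < √p := Real.sqrt_pos.2 hp.1
  have h0 : 0 < √r₀ := Real.sqrt_pos.2 hr₀
  rw [Real.sqrt_div' _ (by positivity), Real.sqrt_sq hq.le,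
    Real.sqrt_mul (hr₀.le.trans hr), Real.rpow_neg hr₀.le, ← Real.sqrt_eq_rpow]
  calc 2 * (approxConst p / (√r * √p / (1 - p)))
      = 2 * approxConst p * (1 - p) / √p * (√r)⁻¹ := by
        field_simp
    _ ≤ _ := by
        gcongr

end LeCam

theorem mainTheorem4 (p : ℝ) (hp : p ∈ Set.Ioo (0 : ℝ) 1) :
    ∃ C : ℝ, 0 < C ∧ ∀ (r₀ : ℝ) (hr₀ : 0 < r₀),
      LeCam.leCamDist (LeCam.negBinExperiment hp hr₀) (LeCam.normalExperiment p r₀) ≤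
        ENNReal.ofReal (C * r₀ ^ (-(1 / 2) : ℝ)) := by
  have hq : 0 < 1 - p := sub_pos.2 hp.2
  have hK := LeCam.approxConst_pos hp
  have hp0 : 0 < √p := Real.sqrt_pos.2 hp.1
  refine ⟨2 * LeCam.approxConst p * (1 - p) / √p, by positivity, fun r₀ hr₀ ↦ max_le ?_ ?_⟩
  · refine iInf₂_le_of_le LeCam.smoothingKernel inferInstance (iSup_le fun r ↦ ?_)
    have hr : 0 < (r : ℝ) := hr₀.trans_le r.2
    have hv : 0 < (r : ℝ) * p / (1 - p) ^ 2 := div_pos (mul_pos hr hp.1) (by positivity)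
    refine (LeCam.tvNorm_le_of_forall_real_sub_le fun A hA ↦ ?_).trans
      (ENNReal.ofReal_le_ofReal (LeCam.two_mul_approxConst_div_sqrt_le hp hr₀ r.2))
    exact LeCam.abs_real_bind_sub_real_gaussianReal_le hr hp (Real.sqrt_pos.2 hv)
      (Real.sq_sqrt hv.le) hA
  · refine iInf₂_le_of_le (Kernel.deterministic LeCam.roundNat LeCam.measurable_roundNat)
      inferInstance (iSup_le fun r ↦ ?_)
    have hr : 0 < (r : ℝ) := hr₀.trans_le r.2
    have hv : 0 < (r : ℝ) * p / (1 - p) ^ 2 := div_pos (mul_pos hr hp.1) (by positivity)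
    refine (LeCam.tvNorm_le_of_forall_real_sub_le fun B hB ↦ ?_).trans
      (ENNReal.ofReal_le_ofReal (LeCam.two_mul_approxConst_div_sqrt_le hp hr₀ r.2))
    -- both laws are images under rounding, so the discrepancy at `B` is one at its preimage
    have h := LeCam.abs_real_bind_sub_real_gaussianReal_le hr hp (Real.sqrt_pos.2 hv)
      (Real.sq_sqrt hv.le) (LeCam.measurable_roundNat hB)
    rw [Measure.deterministic_comp_eq_map, abs_sub_comm,
      map_measureReal_apply LeCam.measurable_roundNat hB]
    rwa [← map_measureReal_apply LeCam.measurable_roundNat hB,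
      LeCam.map_roundNat_bind_smoothingKernel] at h
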